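/- Let $\mathbb X,\mathbb Y$ be finite alphabets, $p_0$ a PMF on $\mathbb X$ and $p_{\hat X|X}$ a conditional PMF on $\mathbb X$ given $\mathbb X$. For $L$ agents and blocklength $n$, let $(X^n,\hat X_1^n,\dots,\hat X_L^n)\sim\prod_{i=1}^n p_0(x_i)\prod_{l=1}^L p_{\hat X|X}(\hat x_{l,i}|x_i)$. A code of rate $R$ per agent consists of encoders $i_l:\mathbb X^n\to\{1,\dots,\lfloor 2^{nR}\rfloor\}$, $l=1,\dots,L$, and a decoder $y^n:\{1,\dots,\lfloor 2^{nR}\rfloor\}^L\to\mathbb Y^n$; it produces $Y^n=y^n(i_1(\hat X_1^n),\dots,i_L(\hat X_L^n))$. Let $P_{X^n,Y^n}(x,y)=\frac1n\sum_{i=1}^n\mathbf 1\{(X_i,Y_i)=(x,y)\}$ be the joint type and $\|p-q\|_{TV}=\frac12\sum|p-q|$. A pair $(R,p_{Y|X})$, with $p_{Y|X}$ a conditional PMF on $\mathbb Y$ given $\mathbb X$, is achievable (for perfect empirical coordination with $L\to\infty$) if there is a family of codes of rate $R$ per agent, one for each pair $(n,L)$, such that $\|P_{X^n,Y^n}-p_0p_{Y|X}\|_{TV}\to0$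 in probability, where the limits in $L$ and in $n$ are taken one after the other: for every $\varepsilon>0$, $$\lim_{n\to\infty}\limsup_{L\to\infty}\Pr\big[\|P_{X^n,Y^n}-p_0p_{Y|X}\|_{TV}>\varepsilon\big]=0 ,$$ and for the same codes also $$\lim_{L\to\infty}\limsup_{n\to\infty}\Pr\big[\|P_{X^n,Y^n}-p_0p_{Y|X}\|_{TV}>\varepsilon\big]=0 .$$ The coordination capacity region $C^P_{p_{X,\hat X}}$ is the closure (in $\mathbb R\times\mathbb R^{\mathbb X\times\mathbb Y}$) of the set of achievable pairs $(R,p_{Y|X})$. Theorem. For every such $p_0$ and $p_{\hat X|X}$, $$C^P_{p_{X,\hat X}}\supseteq \mathbf{Cl}\big\{(R_{\rm ag},p_{Y|X}):\ X-\hat X-Y,\ R_{\rm ag}\ge I(\hat X;Y|X)\big\}.$$ Here a pair belongs to the set on the right if there is a joint PMF of $(X,\hat X,Y)$ with marginals $p_0(x)p_{\hat X|X}(\hat x|x)$ and $p_0(x)p_{Y|X}(y|x)$ for which $X-\hat X-Y$ is a Markov chain and $I(\hat X;Y|X)\le R_{\rm ag}$, with $I$ in bits. -/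

import Mathlib

namespace Coordination

/-- The joint type (empirical probability mass function) of a pair of sequences of length `n`. -/
noncomputable def jointType {X Y : Type*} [DecidableEq X] [DecidableEq Y] {n : ℕ}
    (x : Fin n → X) (y : Fin n → Y) : X × Y → ℝ :=
  fun ab => (1 / (n : ℝ)) * ∑ i : Fin n, if (x i, y i) = ab then (1 : ℝ) else 0

/-- Total variation between two probability mass functions on a finite alphabet. -/
noncomputable def tvDist {A : Type*} [Fintype A] (p q : A → ℝ) : ℝ :=
  (1 / 2) * ∑ a, |p a - q a|

/-- `q x y` is a conditional probability mass function of `y` given `x`. -/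
def IsCondPMF {A B : Type*} [Fintype B] (q : A → B → ℝ) : Prop :=
  ∀ a, q a ∈ stdSimplex ℝ B

/-- The number of messages at rate `R` (in bits per symbol) and blocklength `n`,
the integer part of `2 ^ (n R)`. -/
noncomputable def numMessages (n : ℕ) (R : ℝ) : ℕ :=
  ⌊(2 : ℝ) ^ ((n : ℝ) * R)⌋₊

/-- A `(2^{n R_1}, …, 2^{n R_L}, n)` coordination code: `L` encoders, each of which sees only
its own length-`n` observation, and one decoder, which sees all the messages. -/
structure Code (X Y : Type*) (L n : ℕ) (R : Fin L → ℝ) where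
  enc : (l : Fin L) → (Fin n → X) → Fin (numMessages n (R l))
  dec : ((l : Fin L) → Fin (numMessages n (R l))) → (Fin n → Y)

/-- The action sequence `Y^n` produced from the observations of the `L` agents. -/
def Code.output {X Y : Type*} {L n : ℕ} {R : Fin L → ℝ} (c : Code X Y L n R)
    (xh : Fin L → Fin n → X) : Fin n → Y :=
  c.dec fun l => c.enc l (xh l)

/-- The probability of `(x^n, x̂_1^n, …, x̂_L^n)`: i.i.d. in time, and at each time the `L`
observations are conditionally independent given the source symbol, with law `W (x i)`. -/
noncomputable def sourceProb {X : Type*} (p0 : X → ℝ) (W : X → X → ℝ) {L n : ℕ}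
    (x : Fin n → X) (xh : Fin L → Fin n → X) : ℝ :=
  ∏ i : Fin n, (p0 (x i) * ∏ l : Fin L, W (x i) (xh l i))

/-- The probability that the joint type of `(X^n, Y^n)` is at total variation more than `ε`
from the target `p0(x) q(y|x)`. -/
noncomputable def deviationProb {X Y : Type*} [Fintype X] [DecidableEq X] [Fintype Y]
    [DecidableEq Y] (p0 : X → ℝ) (W : X → X → ℝ) (q : X → Y → ℝ) {L n : ℕ} {R : Fin L → ℝ}
    (c : Code X Y L n R) (ε : ℝ) : ℝ :=
  ∑ x : Fin n → X, ∑ xh : Fin L → Fin n → X,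
    if ε < tvDist (jointType x (c.output xh)) (fun ab => p0 ab.1 * q ab.1 ab.2)
      then sourceProb p0 W x xh else 0

/-- `p0(x) q(y|x)` is achievable for perfect empirical coordination with an unbounded number
of agents at the rate `R` per agent. The convergence to `0` in probability is required in both
senses of taking the limits one after the other, for one family of codes:
`lim_n limsup_L Pr[TV > ε] = 0` (for each fixed large `n`, let `L → ∞`; then `n → ∞`) and
`lim_L limsup_n Pr[TV > ε] = 0` (first fix a large `L`, then let `n → ∞`). -/
def Achievable {X Y : Type*} [Fintype X] [DecidableEq X] [Fintype Y] [DecidableEq Y]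
    (p0 : X → ℝ) (W : X → X → ℝ) (R : ℝ) (q : X → Y → ℝ) : Prop :=
  ∃ c : (n L : ℕ) → Code X Y L n (fun _ => R),
    (∀ ε > 0, ∀ δ > 0, ∀ᶠ n in Filter.atTop, ∀ᶠ L in Filter.atTop,
      deviationProb p0 W q (c n L) ε < δ) ∧
    (∀ ε > 0, ∀ δ > 0, ∀ᶠ L in Filter.atTop, ∀ᶠ n in Filter.atTop,
      deviationProb p0 W q (c n L) ε < δ)

/-- The coordination capacity region for `L → ∞`: the closure of the set of achievable pairs
`(R, p_{Y|X})`. -/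
def capacityRegion {X : Type*} (Y : Type*) [Fintype X] [DecidableEq X] [Fintype Y]
    [DecidableEq Y] (p0 : X → ℝ) (W : X → X → ℝ) : Set (ℝ × (X → Y → ℝ)) :=
  closure {a | IsCondPMF a.2 ∧ Achievable p0 W a.1 a.2}

/-- The Markov chain `A - B - C` for a joint probability mass function `p a b c`:
`p(a,b,c) p(b) = p(a,b) p(b,c)`. -/
def IsMarkovChain {A B C : Type*} [Fintype A] [Fintype C] (p : A → B → C → ℝ) : Prop :=
  ∀ a b c, p a b c * (∑ a', ∑ c', p a' b c') = (∑ c', p a b c') * (∑ a', p a' b c)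

/-- Conditional mutual information `I(B;C|A)` in bits of a joint probability mass function
`p a b c`. -/
noncomputable def condMutualInfo {A B C : Type*} [Fintype A] [Fintype B] [Fintype C]
    (p : A → B → C → ℝ) : ℝ :=
  ∑ a, ∑ b, ∑ c, p a b c *
    Real.logb 2 ((p a b c * ∑ b', ∑ c', p a b' c') / ((∑ c', p a b c') * ∑ b', p a b' c))

/-- `p x x̂ y` is a joint probability mass function of `(X, X̂, Y)` with `(X, X̂)`-law
`p0(x) W(x̂|x)` and `(X, Y)`-law `p0(x) q(y|x)`. -/
def IsJointPMF {X Y : Type*} [Fintype X] [Fintype Y] (p0 : X → ℝ) (W : X → X → ℝ)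
    (q : X → Y → ℝ) (p : X → X → Y → ℝ) : Prop :=
  (∀ x xh y, 0 ≤ p x xh y) ∧
  (∀ x xh, ∑ y, p x xh y = p0 x * W x xh) ∧
  (∀ x y, ∑ xh, p x xh y = p0 x * q x y)

/-- The pairs `(R, p_{Y|X})` with `X - X̂ - Y` and `R ≥ I(X̂;Y|X)`. -/
def innerRegion {X : Type*} (Y : Type*) [Fintype X] [Fintype Y]
    (p0 : X → ℝ) (W : X → X → ℝ) : Set (ℝ × (X → Y → ℝ)) :=
  {a | IsCondPMF a.2 ∧ ∃ p : X → X → Y → ℝ,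
    IsJointPMF p0 W a.2 p ∧ IsMarkovChain p ∧ condMutualInfo p ≤ a.1}

end Coordination

/-! With many agents every positive rate suffices. Choose `s` such that `n / s` symbols of `X` fit
uncoded into `nR` bits. Once `L * (n / s) ≥ n`, the agents can share out the `n` times, and the
decoder learns one observation of each `X_i`. The Markov chain gives a channel `v` from `X̂` to `Y`
(`exists_channel`). If the decoder simulates `v` by independent random maps `f i`, the pairs `(X_i,
Y_i)` are i.i.d. with law `p0 q`, so the mean squared distance of the joint type from its target is
at most `1 / n` (`sum_sqDist_le`). Some fixed choice of maps does as well as the average, and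
Chebyshev's inequality concludes.

Mutual information enters only through its nonnegativity, which gives `R ≥ 0`; the closure then
covers `R = 0`. -/

open Filter Topology

namespace Coordination

/-! ### Sums against product weights. -/

section FiniteSums

variable {ι A : Type*} [Fintype ι] [DecidableEq ι] [Fintype A]

theorem sum_prod_mul_apply (h : ι → A → ℝ) (hh : ∀ i, ∑ a, h i a = 1) (i : ι) (φ : A → ℝ) :
    ∑ z : ι → A, (∏ k, h k (z k)) * φ (z i) = ∑ a, h i a * φ a := by
  -- Absorbed as a factor equal to 1 off `i`, the test function leaves a product over coordinates,
  -- whose sum factorizes.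
  have h1 : ∀ z : ι → A, (∏ k, h k (z k)) * φ (z i)
      = ∏ k, (h k (z k) * if k = i then φ (z k) else 1) := by
    intro z
    rw [Finset.prod_mul_distrib, Finset.prod_ite_eq' Finset.univ i fun k => φ (z k)]
    simp
  simp_rw [h1]
  rw [← Fintype.prod_sum fun k a => h k a * if k = i then φ a else 1]
  rw [Finset.prod_eq_single i]
  · simp
  · intro k _ hk
    simp [hk, hh]
  · simp

theorem sum_prod_mul_apply_mul_apply (h : A → ℝ) {i j : ι} (hij : i ≠ j)
    (φ ψ : A → ℝ) (hφ : ∑ a, h a * φ a = 0) :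
    ∑ z : ι → A, (∏ k, h (z k)) * (φ (z i) * ψ (z j)) = 0 := by
  have h1 : ∀ z : ι → A, (∏ k, h (z k)) * (φ (z i) * ψ (z j))
      = ∏ k, (h (z k) * ((if k = i then φ (z k) else 1) * if k = j then ψ (z k) else 1)) := by
    intro z
    rw [Finset.prod_mul_distrib, Finset.prod_mul_distrib,
      Finset.prod_ite_eq' Finset.univ i fun k => φ (z k),
      Finset.prod_ite_eq' Finset.univ j fun k => ψ (z k)]
    simp
  simp_rw [h1]
  rw [← Fintype.prod_sum fun k a =>
    h a * ((if k = i then φ a else 1) * if k = j then ψ a else 1)]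
  exact Finset.prod_eq_zero (Finset.mem_univ i) (by simp [hij, hφ])

/-- The second moment of a sum of independent centred random variables. -/
theorem sum_prod_mul_sq_sum (h : A → ℝ) (hh : ∑ a, h a = 1) (g : ι → A → ℝ)
    (hg : ∀ i, ∑ a, h a * g i a = 0) :
    ∑ z : ι → A, (∏ k, h (z k)) * (∑ i, g i (z i)) ^ 2 = ∑ i, ∑ a, h a * g i a ^ 2 := by
  simp_rw [sq (∑ i, g i _), Finset.sum_mul_sum, Finset.mul_sum]
  rw [Finset.sum_comm]
  refine Finset.sum_congr rfl fun i _ => ?_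
  rw [Finset.sum_comm, Finset.sum_eq_single i]
  · rw [← sum_prod_mul_apply (fun _ : ι => h) (fun _ => hh) i fun a => g i a ^ 2]
    simp_rw [sq]
  · intro j _ hj
    exact sum_prod_mul_apply_mul_apply h hj.symm (g i) (g j) (hg i)
  · simp

/-- This derandomizes the decoder: `a` will be a choice of maps and `G a` its mean squared distance.
-/
theorem exists_le_of_weighted_sum_le (u G : A → ℝ) (hu : ∀ a, 0 ≤ u a) (hu1 : ∑ a, u a = 1)
    {B : ℝ} (hB : ∑ a, u a * G a ≤ B) : ∃ a, G a ≤ B := by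
  by_contra! hcon
  have h0 : ∀ a, 0 ≤ u a * (G a - B) := fun a =>
    mul_nonneg (hu a) (sub_nonneg.2 (hcon a).le)
  have h1 : ∑ a, u a * (G a - B) = 0 := by
    refine le_antisymm ?_ (Finset.sum_nonneg fun a _ => h0 a)
    simp_rw [mul_sub, Finset.sum_sub_distrib, ← Finset.sum_mul, hu1]
    linarith
  have h2 : ∀ a, u a = 0 := fun a =>
    (mul_eq_zero.1 ((Finset.sum_eq_zero_iff_of_nonneg fun a _ => h0 a).1 h1 a
      (Finset.mem_univ a))).resolve_right (sub_pos.2 (hcon a)).ne'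
  simp [h2] at hu1

end FiniteSums

/-! ### Nonnegativity of conditional mutual information. -/

theorem condMutualInfo_nonneg {A B C : Type*} [Fintype A] [Fintype B] [Fintype C]
    (p : A → B → C → ℝ) (hp : ∀ a b c, 0 ≤ p a b c) : 0 ≤ condMutualInfo p := by
  unfold condMutualInfo
  refine Finset.sum_nonneg fun a _ => ?_
  set s := ∑ b', ∑ c', p a b' c' with hs
  set u : B → ℝ := fun b => ∑ c', p a b c' with hu
  set v : C → ℝ := fun c => ∑ b', p a b' c with hv
  have hu0 : ∀ b, 0 ≤ u b := fun b => Finset.sum_nonneg fun c _ => hp a b c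
  have hv0 : ∀ c, 0 ≤ v c := fun c => Finset.sum_nonneg fun b _ => hp a b c
  have hs0 : 0 ≤ s := Finset.sum_nonneg fun b _ => hu0 b
  have hpu : ∀ b c, p a b c ≤ u b := fun b c =>
    Finset.single_le_sum (f := fun c => p a b c) (fun c _ => hp a b c) (Finset.mem_univ c)
  have hpv : ∀ b c, p a b c ≤ v c := fun b c =>
    Finset.single_le_sum (f := fun b => p a b c) (fun b _ => hp a b c) (Finset.mem_univ b)
  have hus : ∀ b, u b ≤ s := fun b =>
    Finset.single_le_sum (f := u) (fun b _ => hu0 b) (Finset.mem_univ b)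
  have hsumv : ∑ c, v c = s := by rw [hs, Finset.sum_comm]
  -- Termwise `log t ≥ 1 - 1/t`; for fixed `a` these lower bounds sum to zero.
  have key : ∀ b c, (p a b c - u b * v c / s) / Real.log 2
      ≤ p a b c * Real.logb 2 ((p a b c * s) / (u b * v c)) := by
    intro b c
    rw [Real.logb, ← mul_div_assoc]
    refine div_le_div_of_nonneg_right ?_ (Real.log_nonneg one_le_two)
    rcases (hp a b c).eq_or_lt with h0 | h0
    · rw [← h0]
      simpa using div_nonneg (mul_nonneg (hu0 b) (hv0 c)) hs0
    · have hub := h0.trans_le (hpu b c)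
      have hvc := h0.trans_le (hpv b c)
      have hsp := hub.trans_le (hus b)
      have ht : 0 < (p a b c * s) / (u b * v c) := by positivity
      have h1 := Real.one_sub_inv_le_log_of_pos ht
      calc p a b c - u b * v c / s = p a b c * (1 - ((p a b c * s) / (u b * v c))⁻¹) := by
            field_simp
        _ ≤ _ := mul_le_mul_of_nonneg_left h1 h0.le
  refine le_trans ?_ (Finset.sum_le_sum fun b _ => Finset.sum_le_sum fun c _ => key b c)
  simp_rw [← Finset.sum_div, Finset.sum_sub_distrib, ← Finset.sum_div, ← Finset.mul_sum]
  rw [← Finset.sum_mul, hsumv]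
  change 0 ≤ (s - s * s / s) / Real.log 2
  rw [mul_self_div_self, sub_self, zero_div]

/-! ### The channel from observation to action, and the one-letter law. -/

section Channel

variable {X Y : Type*} [Fintype X] [Fintype Y]

/-- The Markov chain `X - X̂ - Y` factors the joint law through a channel from `X̂` to `Y`. -/
theorem exists_channel {p0 : X → ℝ} {W : X → X → ℝ} {q : X → Y → ℝ} [Nonempty X]
    (hq : IsCondPMF q) {p : X → X → Y → ℝ} (hp : IsJointPMF p0 W q p) (hM : IsMarkovChain p) :
    ∃ v : X → Y → ℝ, IsCondPMF v ∧ ∀ x y, ∑ b, p0 x * W x b * v b y = p0 x * q x y := by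
  classical
  obtain ⟨x₀⟩ := ‹Nonempty X›
  obtain ⟨hp0, hp1, hp2⟩ := hp
  set s : X → ℝ := fun b => ∑ a, ∑ c, p a b c with hs
  have hs0 : ∀ b, 0 ≤ s b := fun b =>
    Finset.sum_nonneg fun a _ => Finset.sum_nonneg fun c _ => hp0 a b c
  -- A symbol `b` of probability zero needs some PMF, and any will do; `q x₀` is at hand.
  refine ⟨fun b y => if s b = 0 then q x₀ y else (∑ a, p a b y) / s b, ?_, ?_⟩
  · intro b
    by_cases hb : s b = 0
    · simpa [hb] using hq x₀
    · simp only [hb, if_false]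
      refine ⟨fun y => div_nonneg (Finset.sum_nonneg fun a _ => hp0 a b y) (hs0 b), ?_⟩
      rw [← Finset.sum_div, Finset.sum_comm]
      exact div_self hb
  · intro x y
    rw [← hp2]
    refine Finset.sum_congr rfl fun b _ => ?_
    rw [← hp1]
    by_cases hb : s b = 0
    · have h1 : ∀ c, p x b c = 0 := by
        intro c
        have h2 := (Finset.sum_eq_zero_iff_of_nonneg fun a _ =>
          Finset.sum_nonneg fun c _ => hp0 a b c).1 hb x (Finset.mem_univ x)
        exact (Finset.sum_eq_zero_iff_of_nonneg fun c _ => hp0 x b c).1 h2 c (Finset.mem_univ c)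
      simp [h1]
    · simp only [hb, if_false]
      rw [← mul_div_assoc, div_eq_iff hb]
      exact (hM x b y).symm

/-- The law at one time of the source symbol, of the observations and of a random map which
draws an action independently for each possible observation. -/
noncomputable def letterWeight (p0 : X → ℝ) (W : X → X → ℝ) (v : X → Y → ℝ) {L : ℕ}
    (ω : X × (Fin L → X) × (X → Y)) : ℝ :=
  p0 ω.1 * (∏ l, W ω.1 (ω.2.1 l)) * ∏ b, v b (ω.2.2 b)

/-- A random map with independent values, evaluated at an independent point, acts as the channel
`v`: its other values and the other agents sum out to 1. -/
theorem sum_letterWeight_mul [DecidableEq X] {p0 : X → ℝ} {W : X → X → ℝ} {v : X → Y → ℝ}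
    (hW : IsCondPMF W) (hv : IsCondPMF v) {L : ℕ} (l : Fin L) (φ : X → Y → ℝ) :
    ∑ ω : X × (Fin L → X) × (X → Y), letterWeight p0 W v ω * φ ω.1 (ω.2.2 (ω.2.1 l))
      = ∑ x, ∑ b, ∑ y, p0 x * W x b * v b y * φ x y := by
  simp_rw [Fintype.sum_prod_type, letterWeight, mul_assoc, ← Finset.mul_sum]
  refine Finset.sum_congr rfl fun x _ => ?_
  congr 1
  have h1 : ∀ b, ∑ g : X → Y, (∏ b, v b (g b)) * φ x (g b) = ∑ y, v b y * φ x y := fun b =>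
    sum_prod_mul_apply v (fun b => (hv b).2) b (φ x)
  simp_rw [h1]
  exact sum_prod_mul_apply (fun _ : Fin L => W x) (fun _ => (hW x).2) l
    fun b => ∑ y, v b y * φ x y

theorem sum_letterWeight_mul_eq [DecidableEq X] {p0 : X → ℝ} {W : X → X → ℝ} {q v : X → Y → ℝ}
    (hW : IsCondPMF W) (hv : IsCondPMF v)
    (hvq : ∀ x y, ∑ b, p0 x * W x b * v b y = p0 x * q x y) {L : ℕ} (l : Fin L)
    (φ : X → Y → ℝ) :
    ∑ ω : X × (Fin L → X) × (X → Y), letterWeight p0 W v ω * φ ω.1 (ω.2.2 (ω.2.1 l))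
      = ∑ ab : X × Y, p0 ab.1 * q ab.1 ab.2 * φ ab.1 ab.2 := by
  rw [sum_letterWeight_mul hW hv, Fintype.sum_prod_type]
  refine Finset.sum_congr rfl fun x _ => ?_
  rw [Finset.sum_comm]
  refine Finset.sum_congr rfl fun y _ => ?_
  rw [← Finset.sum_mul, hvq]

theorem sourceProb_nonneg {p0 : X → ℝ} {W : X → X → ℝ} (hp0 : p0 ∈ stdSimplex ℝ X)
    (hW : IsCondPMF W) {n L : ℕ} (x : Fin n → X) (xh : Fin L → Fin n → X) :
    0 ≤ sourceProb p0 W x xh :=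
  Finset.prod_nonneg fun i _ =>
    mul_nonneg (hp0.1 _) (Finset.prod_nonneg fun _ _ => (hW (x i)).1 _)

end Channel

/-! ### Uncoded forwarding. -/

section Code

variable {X Y : Type*} [Fintype X]

/-- Agent `l` forwards uncoded its observations at the times `i` with `(j i).1 = l`, and the
decoder applies the maps `f i` to the forwarded symbols. -/
theorem exists_code_output_eq [Nonempty X] {n L m : ℕ} {R : ℝ}
    (hm : Fintype.card X ^ m ≤ numMessages n R) (j : Fin n → Fin L × Fin m)
    (hj : Function.Injective j) (f : Fin n → X → Y) :
    ∃ c : Code X Y L n (fun _ => R), ∀ xh i, c.output xh i = f i (xh (j i).1 i) := by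
  classical
  obtain ⟨x₀⟩ := ‹Nonempty X›
  obtain ⟨e⟩ : Nonempty ((Fin m → X) ↪ Fin (numMessages n R)) := by
    rw [Function.Embedding.nonempty_iff_card_le]
    simpa using hm
  have : Nonempty (Fin m → X) := ⟨fun _ => x₀⟩
  -- Slot `t` of agent `l` carries the symbol at the time `i` with `j i = (l, t)`; unused slots are
  -- padded with `x₀`.
  refine ⟨⟨fun l z => e fun t => Function.extend j z (fun _ => x₀) (l, t),
    fun μ i => f i (Function.invFun e (μ (j i).1) (j i).2)⟩, fun xh i => ?_⟩
  simp only [Code.output]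
  rw [Function.leftInverse_invFun e.injective]
  simp only [Prod.mk.eta]
  rw [hj.extend_apply]

end Code

/-! ### Second moment of the joint type, and Chebyshev's inequality. -/

section SecondMoment

variable {X Y : Type*} [Fintype X] [DecidableEq X] [Fintype Y] [DecidableEq Y]

/-- The squared Euclidean distance from the joint type to `p0(x) q(y|x)`. -/
noncomputable def sqDist (p0 : X → ℝ) (q : X → Y → ℝ) {n : ℕ} (x : Fin n → X) (y : Fin n → Y) :
    ℝ :=
  ∑ ab : X × Y, (jointType x y ab - p0 ab.1 * q ab.1 ab.2) ^ 2

theorem sum_mul_ite_sub {A : Type*} [Fintype A] [DecidableEq A] (π : A → ℝ)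
    (hπ1 : ∑ a, π a = 1) (a : A) :
    ∑ b, π b * ((if b = a then (1 : ℝ) else 0) - π a) = 0 := by
  simp_rw [mul_sub, Finset.sum_sub_distrib, ← Finset.sum_mul, hπ1]
  simp

theorem sum_mul_ite_sub_sq_le {A : Type*} [Fintype A] [DecidableEq A] (π : A → ℝ)
    (hπ1 : ∑ a, π a = 1) (a : A) :
    ∑ b, π b * ((if b = a then (1 : ℝ) else 0) - π a) ^ 2 ≤ π a := by
  have h1 : ∀ b, π b * ((if b = a then (1 : ℝ) else 0) - π a) ^ 2
      = (if b = a then π b * (1 - 2 * π a) else 0) + π b * π a ^ 2 := by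
    intro b
    split_ifs <;> ring
  simp_rw [h1, Finset.sum_add_distrib, ← Finset.sum_mul, hπ1]
  simp only [Finset.sum_ite_eq', Finset.mem_univ, if_true]
  nlinarith [sq_nonneg (π a)]

/-- Transposition of a sequence of letters into a triple of sequences. -/
def letterEquiv (X Y : Type*) (n L : ℕ) :
    (Fin n → X × (Fin L → X) × (X → Y)) ≃
      (Fin n → X → Y) × (Fin n → X) × (Fin L → Fin n → X) where
  toFun ω := (fun i => (ω i).2.2, fun i => (ω i).1, fun l i => (ω i).2.1 l)
  invFun t := fun i => (t.2.1 i, fun l => t.2.2 l i, t.1 i)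
  left_inv _ := rfl
  right_inv _ := rfl

/-- Averaging over the maps makes the letters i.i.d. across time, so only the variances of the
indicators survive; each is at most `π ab`, and `π` sums to 1. -/
theorem sum_sqDist_le {p0 : X → ℝ} {W : X → X → ℝ} {q v : X → Y → ℝ}
    (hp0 : p0 ∈ stdSimplex ℝ X) (hW : IsCondPMF W) (hq : IsCondPMF q) (hv : IsCondPMF v)
    (hvq : ∀ x y, ∑ b, p0 x * W x b * v b y = p0 x * q x y) {n L : ℕ} (hn : 0 < n)
    (k : Fin n → Fin L) :
    ∑ f : Fin n → X → Y, (∏ i, ∏ b, v b (f i b)) *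
      ∑ x : Fin n → X, ∑ xh : Fin L → Fin n → X,
        sourceProb p0 W x xh * sqDist p0 q x (fun i => f i (xh (k i) i)) ≤ 1 / n := by
  set π : X × Y → ℝ := fun ab => p0 ab.1 * q ab.1 ab.2 with hπ
  have hπ1 : ∑ ab, π ab = 1 := by
    simp_rw [hπ, Fintype.sum_prod_type, ← Finset.mul_sum, (hq _).2, mul_one, hp0.2]
  have hl : ∀ i : Fin n, ∀ φ : X × Y → ℝ,
      ∑ ω : X × (Fin L → X) × (X → Y), letterWeight p0 W v ω * φ (ω.1, ω.2.2 (ω.2.1 (k i)))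
        = ∑ ab, π ab * φ ab := fun i φ =>
    sum_letterWeight_mul_eq hW hv hvq (k i) fun a b => φ (a, b)
  have hw1 : ∑ ω : X × (Fin L → X) × (X → Y), letterWeight p0 W v ω = 1 := by
    have := hl ⟨0, hn⟩ fun _ => 1
    simpa [hπ1] using this
  have hn' : (n : ℝ) ≠ 0 := by positivity
  have hsq : ∀ (x : Fin n → X) (y : Fin n → Y), sqDist p0 q x y = ∑ ab, (1 / (n : ℝ)) ^ 2 *
      (∑ i, ((if (x i, y i) = ab then (1 : ℝ) else 0) - π ab)) ^ 2 := by
    intro x y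
    refine Finset.sum_congr rfl fun ab _ => ?_
    rw [← mul_pow, jointType, Finset.sum_sub_distrib, mul_sub]
    simp [hπ, hn']
  -- Maps, source and observations are regrouped by time, which turns the weight into a product over
  -- letters.
  have hre : ∑ f : Fin n → X → Y, (∏ i, ∏ b, v b (f i b)) *
      ∑ x : Fin n → X, ∑ xh : Fin L → Fin n → X,
        sourceProb p0 W x xh * sqDist p0 q x (fun i => f i (xh (k i) i))
      = ∑ ω : Fin n → X × (Fin L → X) × (X → Y), (∏ i, letterWeight p0 W v (ω i)) *
        sqDist p0 q (fun i => (ω i).1) (fun i => (ω i).2.2 ((ω i).2.1 (k i))) := by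
    symm
    refine (Fintype.sum_equiv (letterEquiv X Y n L) _ (fun t => (∏ i, ∏ b, v b (t.1 i b)) *
      (sourceProb p0 W t.2.1 t.2.2 * sqDist p0 q t.2.1 fun i => t.1 i (t.2.2 (k i) i)))
      fun ω => ?_).trans ?_
    · simp only [letterEquiv, letterWeight, sourceProb, Equiv.coe_fn_mk, Finset.prod_mul_distrib]
      ring
    · simp_rw [Fintype.sum_prod_type, Finset.mul_sum]
  rw [hre]
  simp_rw [hsq, Finset.mul_sum]
  rw [Finset.sum_comm]
  have hab : ∀ ab : X × Y, ∑ ω : Fin n → X × (Fin L → X) × (X → Y),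
      (∏ i, letterWeight p0 W v (ω i)) * ((1 / (n : ℝ)) ^ 2 *
        (∑ i, ((if ((ω i).1, (ω i).2.2 ((ω i).2.1 (k i))) = ab then (1 : ℝ) else 0) - π ab)) ^ 2)
      ≤ 1 / n * π ab := by
    intro ab
    have h1 := sum_prod_mul_sq_sum (letterWeight p0 W v (L := L)) hw1
      (fun (i : Fin n) ω => (if (ω.1, ω.2.2 (ω.2.1 (k i))) = ab then (1 : ℝ) else 0) - π ab)
      fun i => by
        rw [hl i fun cd => (if cd = ab then (1 : ℝ) else 0) - π ab]
        exact sum_mul_ite_sub π hπ1 ab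
    simp_rw [mul_left_comm _ ((1 / (n : ℝ)) ^ 2), ← Finset.mul_sum]
    rw [h1]
    have h2 : ∀ i : Fin n, ∑ ω : X × (Fin L → X) × (X → Y), letterWeight p0 W v ω *
        ((if (ω.1, ω.2.2 (ω.2.1 (k i))) = ab then (1 : ℝ) else 0) - π ab) ^ 2 ≤ π ab := by
      intro i
      rw [hl i fun cd => ((if cd = ab then (1 : ℝ) else 0) - π ab) ^ 2]
      exact sum_mul_ite_sub_sq_le π hπ1 ab
    calc (1 / (n : ℝ)) ^ 2 * _ ≤ (1 / (n : ℝ)) ^ 2 * ∑ _i : Fin n, π ab :=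
          mul_le_mul_of_nonneg_left (Finset.sum_le_sum fun i _ => h2 i) (by positivity)
      _ = 1 / n * π ab := by
          simp
          field_simp
  refine (Finset.sum_le_sum fun ab _ => hab ab).trans_eq ?_
  rw [← Finset.mul_sum, hπ1, mul_one]

/-- Cauchy–Schwarz compares the `ℓ¹` and `ℓ²` distances; the factor `1 / 2` in `tvDist` only adds
slack. -/
theorem sq_lt_card_mul_sqDist {p0 : X → ℝ} {q : X → Y → ℝ} {n : ℕ} {x : Fin n → X}
    {y : Fin n → Y} {ε : ℝ} (hε : 0 < ε)
    (h : ε < tvDist (jointType x y) (fun ab => p0 ab.1 * q ab.1 ab.2)) :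
    ε ^ 2 < Fintype.card (X × Y) * sqDist p0 q x y := by
  have h1 := sq_sum_le_card_mul_sum_sq (s := (Finset.univ : Finset (X × Y)))
    (f := fun ab => |jointType x y ab - p0 ab.1 * q ab.1 ab.2|)
  simp_rw [sq_abs] at h1
  rw [Finset.card_univ] at h1
  refine lt_of_lt_of_le ?_ h1
  unfold tvDist at h
  nlinarith

/-- Chebyshev's inequality for the joint type. -/
theorem deviationProb_le {p0 : X → ℝ} {W : X → X → ℝ} {q : X → Y → ℝ}
    (hp0 : p0 ∈ stdSimplex ℝ X) (hW : IsCondPMF W) {n L : ℕ} {R : Fin L → ℝ}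
    (c : Code X Y L n R) {ε B : ℝ} (hε : 0 < ε)
    (hB : ∑ x : Fin n → X, ∑ xh : Fin L → Fin n → X,
      sourceProb p0 W x xh * sqDist p0 q x (c.output xh) ≤ B) :
    deviationProb p0 W q c ε ≤ Fintype.card (X × Y) / ε ^ 2 * B := by
  have hC : (0 : ℝ) ≤ Fintype.card (X × Y) / ε ^ 2 := by positivity
  refine le_trans ?_ (mul_le_mul_of_nonneg_left hB hC)
  simp_rw [deviationProb, Finset.mul_sum]
  refine Finset.sum_le_sum fun x _ => Finset.sum_le_sum fun xh _ => ?_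
  have hP := sourceProb_nonneg hp0 hW x xh
  have hD : 0 ≤ sqDist p0 q x (c.output xh) := Finset.sum_nonneg fun _ _ => sq_nonneg _
  split_ifs with h
  · have h1 := sq_lt_card_mul_sqDist hε h
    have h2 : 1 ≤ Fintype.card (X × Y) / ε ^ 2 * sqDist p0 q x (c.output xh) := by
      rw [div_mul_eq_mul_div, le_div_iff₀ (by positivity), one_mul]
      exact h1.le
    calc sourceProb p0 W x xh = sourceProb p0 W x xh * 1 := (mul_one _).symm
      _ ≤ _ := mul_le_mul_of_nonneg_left h2 hP
      _ = _ := by ring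
  · positivity

/-- One code serves every `ε`, since the maps are chosen by a second moment that does not involve
`ε`. -/
theorem exists_code_deviationProb_le {p0 : X → ℝ} {W : X → X → ℝ} {q v : X → Y → ℝ}
    (hp0 : p0 ∈ stdSimplex ℝ X) (hW : IsCondPMF W) (hq : IsCondPMF q) (hv : IsCondPMF v)
    (hvq : ∀ x y, ∑ b, p0 x * W x b * v b y = p0 x * q x y) [Nonempty X] {n L m : ℕ} {R : ℝ}
    (hm : Fintype.card X ^ m ≤ numMessages n R) (hn : 0 < n)
    (hnL : n ≤ L * m) :
    ∃ c : Code X Y L n (fun _ => R), ∀ ε > 0,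
      deviationProb p0 W q c ε ≤ Fintype.card (X × Y) / ε ^ 2 * (1 / n) := by
  obtain ⟨j⟩ : Nonempty (Fin n ↪ Fin L × Fin m) := by
    rw [Function.Embedding.nonempty_iff_card_le]
    simpa using hnL
  obtain ⟨f, hf⟩ := exists_le_of_weighted_sum_le
    (fun f : Fin n → X → Y => ∏ i, ∏ b, v b (f i b)) _
    (fun f => Finset.prod_nonneg fun i _ => Finset.prod_nonneg fun b _ => (hv b).1 _)
    (by
      rw [← Fintype.prod_sum fun (_ : Fin n) (g : X → Y) => ∏ b, v b (g b)]
      refine Finset.prod_eq_one fun _ _ => ?_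
      rw [← Fintype.prod_sum]
      exact Finset.prod_eq_one fun b _ => (hv b).2)
    (sum_sqDist_le hp0 hW hq hv hvq hn fun i => (j i).1)
  obtain ⟨c, hc⟩ := exists_code_output_eq hm j j.injective f
  refine ⟨c, fun ε hε => deviationProb_le hp0 hW c hε ?_⟩
  have : ∀ xh, c.output xh = fun i => f i (xh (j i).1 i) := fun xh => funext (hc xh)
  simpa only [this] using hf

end SecondMoment

/-! ### Rates, the two iterated limits, and the closure. -/

theorem exists_card_pow_le_numMessages (K : ℕ) {R : ℝ} (hR : 0 < R) :
    ∃ s : ℕ, 0 < s ∧ ∀ n : ℕ, K ^ (n / s) ≤ numMessages n R := by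
  have h1 : (1 : ℝ) < 2 ^ R := Real.one_lt_rpow one_lt_two hR
  -- A block of `t + 1` times carries enough bits for one symbol.
  obtain ⟨t, ht⟩ := pow_unbounded_of_one_lt (K : ℝ) h1
  refine ⟨t + 1, t.succ_pos, fun n => Nat.le_floor ?_⟩
  have hK : (K : ℝ) ≤ (2 ^ R) ^ (t + 1) := ht.le.trans (pow_le_pow_right₀ h1.le t.le_succ)
  calc ((K ^ (n / (t + 1)) : ℕ) : ℝ) = (K : ℝ) ^ (n / (t + 1)) := by push_cast; rfl
    _ ≤ ((2 ^ R) ^ (t + 1)) ^ (n / (t + 1)) := pow_le_pow_left₀ K.cast_nonneg hK _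
    _ = (2 ^ R) ^ ((t + 1) * (n / (t + 1))) := (pow_mul _ _ _).symm
    _ ≤ (2 ^ R) ^ n := pow_le_pow_right₀ h1.le (Nat.mul_div_le n (t + 1))
    _ = 2 ^ ((n : ℝ) * R) := by
      rw [mul_comm, Real.rpow_mul zero_le_two, Real.rpow_natCast]

variable {X Y : Type*} [Fintype X] [DecidableEq X] [Fintype Y] [DecidableEq Y]

/-- Every positive rate achieves a target which factors through a channel from `X̂` to `Y`. -/
theorem achievable_of_pos {p0 : X → ℝ} {W : X → X → ℝ} {q v : X → Y → ℝ}
    (hp0 : p0 ∈ stdSimplex ℝ X) (hW : IsCondPMF W) (hq : IsCondPMF q) (hv : IsCondPMF v)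
    (hvq : ∀ x y, ∑ b, p0 x * W x b * v b y = p0 x * q x y) [Nonempty X] [Nonempty Y] {R : ℝ}
    (hR : 0 < R) : Achievable p0 W R q := by
  obtain ⟨s, hs, hsn⟩ := exists_card_pow_le_numMessages (Fintype.card X) hR
  have hcode : ∀ n L : ℕ, ∃ c : Code X Y L n (fun _ => R),
      0 < n → n ≤ L * (n / s) → ∀ ε > 0,
      deviationProb p0 W q c ε ≤ Fintype.card (X × Y) / ε ^ 2 * (1 / n) := by
    intro n L
    by_cases h : 0 < n ∧ n ≤ L * (n / s)
    · obtain ⟨c, hc⟩ := exists_code_deviationProb_le hp0 hW hq hv hvq (hsn n) h.1 h.2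
      exact ⟨c, fun _ _ => hc⟩
    · have hpos : 0 < numMessages n R := (pow_pos Fintype.card_pos _).trans_le (hsn n)
      -- With too few agents to cover all times, any code will do: both limits avoid this case.
      exact ⟨⟨fun _ _ => ⟨0, hpos⟩, fun _ _ => Classical.arbitrary Y⟩, 
        fun h₀ h₁ => absurd ⟨h₀, h₁⟩ h⟩
  choose c hc using hcode
  have hlim : ∀ ε > 0, ∀ δ > 0, ∀ᶠ n : ℕ in atTop,
      (Fintype.card (X × Y) : ℝ) / ε ^ 2 * (1 / n) < δ := by
    intro ε _ δ hδ
    have := (tendsto_one_div_atTop_nhds_zero_nat (𝕜 := ℝ)).const_mul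
      ((Fintype.card (X × Y) : ℝ) / ε ^ 2)
    rw [mul_zero] at this
    exact this.eventually_lt_const hδ
  refine ⟨c, fun ε hε δ hδ => ?_, fun ε hε δ hδ => ?_⟩
  · filter_upwards [hlim ε hε δ hδ, eventually_ge_atTop s] with n hn hsn
    -- For fixed `n ≥ s` each agent forwards at least one symbol, so `n` agents suffice.
    filter_upwards [eventually_ge_atTop n] with L hL
    refine (hc n L (hs.trans_le hsn) ?_ ε hε).trans_lt hn
    exact hL.trans (Nat.le_mul_of_pos_right L (Nat.div_pos hsn hs))
  -- The number of agents must not depend on `n`; the factor 2 absorbs the rounding in `n / s`.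
  · filter_upwards [eventually_ge_atTop (2 * s)] with L hL
    filter_upwards [hlim ε hε δ hδ, eventually_ge_atTop s] with n hn hsn
    refine (hc n L (hs.trans_le hsn) ?_ ε hε).trans_lt hn
    have h1 : 1 ≤ n / s := Nat.div_pos hsn hs
    have h2 : n < s * (n / s + 1) := Nat.lt_mul_div_succ n hs
    calc n ≤ s * (n / s + 1) := h2.le
      _ ≤ 2 * s * (n / s) := by nlinarith
      _ ≤ L * (n / s) := Nat.mul_le_mul_right _ hL

end Coordination

theorem theorem2 {X Y : Type*} [Fintype X] [DecidableEq X] [Fintype Y] [DecidableEq Y]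
    (p0 : X → ℝ) (W : X → X → ℝ) (hp0 : p0 ∈ stdSimplex ℝ X)
    (hW : Coordination.IsCondPMF W) :
    closure (Coordination.innerRegion Y p0 W) ⊆ Coordination.capacityRegion Y p0 W := by
  refine closure_minimal ?_ isClosed_closure
  rintro ⟨R, q⟩ ⟨hq, p, hp, hM, hI⟩
  have : Nonempty X := by
    by_contra hX
    rw [not_nonempty_iff] at hX
    simpa using hp0.2
  have : Nonempty Y := by
    by_contra hY
    rw [not_nonempty_iff] at hY
    simpa using (hq (Classical.arbitrary X)).2
  obtain ⟨v, hv, hvq⟩ := Coordination.exists_channel hq hp hM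
  have hR : 0 ≤ R := (Coordination.condMutualInfo_nonneg p hp.1).trans hI
  -- Raising the rate makes it strictly positive, as `achievable_of_pos` requires.
  have hlim : Tendsto (fun k : ℕ => (R + 1 / ((k : ℝ) + 1), q)) atTop (𝓝 (R, q)) := by
    refine Tendsto.prodMk_nhds ?_ tendsto_const_nhds
    simpa using tendsto_const_nhds.add (tendsto_one_div_add_atTop_nhds_zero_nat (𝕜 := ℝ))
  exact mem_closure_of_tendsto hlim <| Eventually.of_forall fun k =>
    ⟨hq, Coordination.achievable_of_pos hp0 hW hq hv hvq (by positivity)⟩
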